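/- Let $N \ge 0$ and let $f:\{0,1\}^N\to\{0,1\}$ be a total Boolean function of $X=(x_0,\dots,x_{N-1})$. Let $D(f)$ be the deterministic decision tree complexity of $f$: the minimum depth of a binary tree whose inner nodes query variables $x_i$ (the two children corresponding to the outcomes $0$ and $1$), whose leaves carry answers in $\{0,1\}$, and which gives the answer $f(X)$ on every input $X\in\{0,1\}^N$. A quantum network with $T$ queries acts on some number $m\ge\lceil\log_2 N\rceil+1$ of qubits, whose basis states are written $|i,b,z\rangle$ with $i$ of $\lceil\log_2 N\rceil$ bits, $b$ one bit and $z$ a string of the remaining bits. It is given by arbitrary unitary transformations $U_0,\dots,U_T$ that do not depend on $X$. On input $X$ its final state is $U_T O_X U_{T-1} O_X\cdots U_1 O_X U_0|0\cdots 0\rangle$, where $O_X$ is the query $|i,b,z\rangle\mapsto|i,b\oplus x_i,z\rangle$ (with $x_i:=0$ for $i\ge N$). Its output is the value observed when the rightmost bit of the final state is measured. It computes $f$ with bounded error if, for every $X\in\{0,1\}^N$, the output equals $f(X)$ with probability at least $2/3$. Let $Q_2(f)$ be the minimum $T$ for which there is a quantum network with $T$ queries that computes $f$ with bounded error. Then $$D(f)\le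 4096\,Q_2(f)^6 .$$ Moreover, whenever a quantum network with $T$ queries computes $f$ with bounded error, there is a deterministic decision tree of depth at most $4096\,T^6$ that computes $f$. -/

import Mathlib

/-! ### Deterministic decision trees -/

/-- An input `X = (x_0, …, x_{N-1})`, an `N`-tuple of Boolean variables. -/
abbrev BoolInput (N : ℕ) : Type := Fin N → Bool

/-- A deterministic decision tree over `N` Boolean variables: a leaf carries the answer, an inner
node queries a variable and continues with the first subtree if the variable is `0` and with the
second subtree if it is `1`. -/
inductive DecisionTree (N : ℕ) : Type
  | leaf (answer : Bool) : DecisionTree N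
  | node (i : Fin N) (ifZero ifOne : DecisionTree N) : DecisionTree N

/-- The answer of a decision tree on an input. -/
def DecisionTree.eval {N : ℕ} : DecisionTree N → BoolInput N → Bool
  | .leaf answer, _ => answer
  | .node i ifZero ifOne, X => if X i then ifOne.eval X else ifZero.eval X

/-- The cost of a decision tree: its depth, counted in queries. -/
def DecisionTree.depth {N : ℕ} : DecisionTree N → ℕ
  | .leaf _ => 0
  | .node _ ifZero ifOne => max ifZero.depth ifOne.depth + 1

/-- A decision tree computes the total function `f` if it gives the right answer on every input. -/
def DecisionTree.Computes {N : ℕ} (t : DecisionTree N) (f : BoolInput N → Bool) : Prop :=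
  ∀ X, t.eval X = f X

/-- The decision tree complexity `D(f)`: the least depth of a decision tree that computes `f`.
(The minimum is over a non-empty set by `exists_decisionTree_computes` below.) -/
noncomputable def decisionTreeComplexity {N : ℕ} (f : BoolInput N → Bool) : ℕ :=
  sInf {d : ℕ | ∃ t : DecisionTree N, t.Computes f ∧ t.depth = d}

/-! ### Quantum networks -/

/-- The number `⌈log₂ N⌉` of qubits of the index register. -/
def indexLength (N : ℕ) : ℕ := Nat.clog 2 N

/-- The basis states of a network on `m = ⌈log₂ N⌉ + 1 + w` qubits: bit strings of length `m`,
where position `0` is the leftmost bit. Such a string is read as `|i, b, z⟩` with `i` of length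
`⌈log₂ N⌉`, `b` one bit, and `z` of length `w`. -/
abbrev BasisState (N w : ℕ) : Type := Fin (indexLength N + w + 1) → Bool

/-- The number `i` of the basis state `|i, b, z⟩`, written in binary, leftmost bit most
significant. -/
def BasisState.queryIndex {N w : ℕ} (s : BasisState N w) : ℕ :=
  Nat.ofBits fun j : Fin (indexLength N) => s ⟨j.rev, by omega⟩

/-- The position of the bit `b` in the basis state `|i, b, z⟩`. -/
def targetPos (N w : ℕ) : Fin (indexLength N + w + 1) := ⟨indexLength N, by omega⟩

/-- The bit returned by the black-box `X` on the index `i`: this is `x_i`, and `0` for the unused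
indices `N ≤ i < 2 ^ ⌈log₂ N⌉`. -/
def blackBox {N : ℕ} (X : BoolInput N) (i : ℕ) : Bool :=
  if h : i < N then X ⟨i, h⟩ else false

/-- The action `|i, b, z⟩ ↦ |i, b ⊕ x_i, z⟩` of a query on basis states. -/
def queryMap {N : ℕ} (w : ℕ) (X : BoolInput N) (s : BasisState N w) : BasisState N w :=
  Function.update s (targetPos N w) (xor (s (targetPos N w)) (blackBox X s.queryIndex))

/-- The query transformation `O`, the linear map with `O |s⟩ = |queryMap X s⟩`, as a matrix. -/
def queryMatrix {N : ℕ} (w : ℕ) (X : BoolInput N) :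
    Matrix (BasisState N w) (BasisState N w) ℂ :=
  Matrix.of fun s' s => if s' = queryMap w X s then 1 else 0

/-- A quantum network with `T` queries for inputs of length `N`: a number `w` of additional qubits
and arbitrary unitary transformations `U_0, …, U_T`, which do not depend on the input. -/
structure QuantumNetwork (N T : ℕ) where
  w : ℕ
  U : Fin (T + 1) → Matrix.unitaryGroup (BasisState N w) ℂ

namespace QuantumNetwork

variable {N T : ℕ}

/-- The initial state `|0 … 0⟩`. -/
def initialState (𝒩 : QuantumNetwork N T) : BasisState N 𝒩.w → ℂ :=
  Pi.single (fun _ => false) 1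

/-- The state after `U_0, O, U_1, O, …, O, U_t` on the input `X`. -/
def stateAt (𝒩 : QuantumNetwork N T) (X : BoolInput N) :
    Fin (T + 1) → (BasisState N 𝒩.w → ℂ) :=
  Fin.induction ((𝒩.U 0).1.mulVec 𝒩.initialState)
    fun t ψ => (𝒩.U t.succ).1.mulVec ((queryMatrix 𝒩.w X).mulVec ψ)

/-- The final state `U_T O U_{T-1} O ⋯ O U_0 |0 … 0⟩`, in which `T` queries have been made. -/
def finalState (𝒩 : QuantumNetwork N T) (X : BoolInput N) : BasisState N 𝒩.w → ℂ :=
  𝒩.stateAt X (Fin.last T)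

/-- The probability of observing the value `b` when the rightmost bit of the final state is
measured. -/
noncomputable def outputProb (𝒩 : QuantumNetwork N T) (X : BoolInput N) (b : Bool) : ℝ :=
  ∑ s : BasisState N 𝒩.w,
    if s (Fin.last (indexLength N + 𝒩.w)) = b then ‖𝒩.finalState X s‖ ^ 2 else 0

/-- The network computes `f` with bounded error: on every input the output is right with
probability at least `2/3`. -/
def ComputesBoundedError (𝒩 : QuantumNetwork N T) (f : BoolInput N → Bool) : Prop :=
  ∀ X, 2 / 3 ≤ 𝒩.outputProb X (f X)

end QuantumNetwork

/-- The bounded-error quantum query complexity `Q₂(f)`: the least number of queries of a quantum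
network that computes `f` with bounded error. (The minimum is over a non-empty set by
`exists_network_computesBoundedError` below.) -/
noncomputable def boundedErrorQuantumComplexity {N : ℕ} (f : BoolInput N → Bool) : ℕ :=
  sInf {T : ℕ | ∃ 𝒩 : QuantumNetwork N T, 𝒩.ComputesBoundedError f}

/-! ### The two minima are taken over non-empty sets, and queries are unitary -/

theorem exists_decisionTree_aux {N : ℕ} (f : BoolInput N → Bool) (k : ℕ) (hk : k ≤ N) :
    ∀ Y : BoolInput N, ∃ t : DecisionTree N, ∀ X : BoolInput N,
      (∀ j : Fin N, k ≤ j.1 → X j = Y j) → t.eval X = f X := by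
  induction k with
  | zero =>
    intro Y
    refine ⟨.leaf (f Y), fun X h => ?_⟩
    have : X = Y := funext fun j => h j (Nat.zero_le _)
    rw [this, DecisionTree.eval]
  | succ k ih =>
    intro Y
    obtain ⟨t₀, h₀⟩ := ih (by omega) (Function.update Y ⟨k, hk⟩ false)
    obtain ⟨t₁, h₁⟩ := ih (by omega) (Function.update Y ⟨k, hk⟩ true)
    refine ⟨.node ⟨k, hk⟩ t₀ t₁, fun X h => ?_⟩
    have key : ∀ b, X ⟨k, hk⟩ = b → ∀ j : Fin N, k ≤ j.1 →
        X j = Function.update Y ⟨k, hk⟩ b j := by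
      intro b hb j hj
      by_cases hjk : j = ⟨k, hk⟩
      · subst hjk; simp [hb]
      · rw [Function.update_of_ne hjk]
        refine h j ?_
        have : j.1 ≠ k := fun e => hjk (Fin.ext e)
        omega
    rw [DecisionTree.eval]
    cases hb : X ⟨k, hk⟩
    · simpa using h₀ X (key _ hb)
    · simpa using h₁ X (key _ hb)

theorem exists_decisionTree_computes {N : ℕ} (f : BoolInput N → Bool) :
    ∃ t : DecisionTree N, t.Computes f := by
  obtain ⟨t, ht⟩ := exists_decisionTree_aux f N le_rfl (fun _ => false)
  exact ⟨t, fun X => ht X fun j hj => absurd j.2 (by omega)⟩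

theorem queryMap_involutive {N : ℕ} (w : ℕ) (X : BoolInput N) :
    Function.Involutive (queryMap w X) := by
  intro s
  have h : (queryMap w X s).queryIndex = s.queryIndex := by
    unfold BasisState.queryIndex
    congr 1
    funext j
    refine Function.update_of_ne (fun e => ?_) _ _
    have h1 := congrArg Fin.val e
    have h2 := j.rev.2
    simp only [targetPos] at h1
    omega
  have h' : queryMap w X s (targetPos N w) =
      xor (s (targetPos N w)) (blackBox X s.queryIndex) := by
    simp [queryMap]
  rw [queryMap, h, h']
  simp [queryMap]

/-- The matrix of the linear map that permutes the basis states by `σ`. -/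
def basisPermMatrix {β : Type*} [DecidableEq β] (σ : Equiv.Perm β) : Matrix β β ℂ :=
  Matrix.of fun s' s => if s' = σ s then 1 else 0

theorem basisPermMatrix_mem_unitaryGroup {β : Type*} [Fintype β] [DecidableEq β]
    (σ : Equiv.Perm β) : basisPermMatrix σ ∈ Matrix.unitaryGroup β ℂ := by
  rw [Matrix.mem_unitaryGroup_iff']
  ext s s'
  simp [basisPermMatrix, Matrix.mul_apply, Matrix.star_apply, Matrix.one_apply, eq_comm]

theorem basisPermMatrix_mulVec_single {β : Type*} [Fintype β] [DecidableEq β]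
    (σ : Equiv.Perm β) (s : β) :
    (basisPermMatrix σ).mulVec (Pi.single s 1) = Pi.single (σ s) 1 := by
  ext s'
  simp [basisPermMatrix, Pi.single_apply]

theorem queryMatrix_eq_basisPermMatrix {N : ℕ} (w : ℕ) (X : BoolInput N) :
    queryMatrix w X = basisPermMatrix (queryMap_involutive w X).toPerm := rfl

theorem queryMatrix_mem_unitaryGroup {N : ℕ} (w : ℕ) (X : BoolInput N) :
    queryMatrix w X ∈ Matrix.unitaryGroup (BasisState N w) ℂ := by
  rw [queryMatrix_eq_basisPermMatrix]
  exact basisPermMatrix_mem_unitaryGroup _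

theorem exists_perm_apply_eq {α β : Type*} [Finite β] (g h : α → β)
    (hgh : ∀ x y, g x = g y ↔ h x = h y) : ∃ σ : Equiv.Perm β, ∀ x, σ (g x) = h x := by
  classical
  let F : Set.range g → Set.range h := fun b => ⟨h b.2.choose, Set.mem_range_self _⟩
  have hF : ∀ x, F ⟨g x, Set.mem_range_self x⟩ = ⟨h x, Set.mem_range_self x⟩ := by
    intro x
    apply Subtype.ext
    exact (hgh _ _).1 (Set.mem_range_self (f := g) x).choose_spec
  have hb : Function.Bijective F := by
    constructor
    · rintro ⟨_, x, rfl⟩ ⟨_, y, rfl⟩ e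
      rw [hF, hF, Subtype.mk.injEq] at e
      exact Subtype.ext ((hgh _ _).2 e)
    · rintro ⟨_, x, rfl⟩
      exact ⟨_, hF x⟩
  have := Fintype.ofFinite β
  refine ⟨(Equiv.ofBijective F hb).extendSubtype, fun x => ?_⟩
  rw [Equiv.extendSubtype_apply_of_mem _ _ (Set.mem_range_self x)]
  exact congrArg Subtype.val (hF x)

/-- The basis state in which the index register holds `t`, the bits `x_0, …, x_{t-1}` have been
recorded, and, if `t = N`, the rightmost bit is `f X`. -/
def recordState {N : ℕ} (f : BoolInput N → Bool) (t : ℕ) (X : BoolInput N) :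
    BasisState N (N + 1) :=
  fun p =>
    if p.1 < indexLength N then t.testBit (indexLength N - 1 - p.1)
    else if p.1 = indexLength N then false
    else if p.1 = indexLength N + N + 1 then decide (t = N) && f X
    else decide (p.1 - indexLength N - 1 < t) && blackBox X (p.1 - indexLength N - 1)

theorem recordState_queryIndex {N : ℕ} (f : BoolInput N → Bool) (t : ℕ) (ht : t < N)
    (X : BoolInput N) : (recordState f t X).queryIndex = t := by
  have h2 : t < 2 ^ indexLength N :=
    lt_of_lt_of_le ht (Nat.le_pow_clog (by norm_num) N)
  have : (fun j : Fin (indexLength N) => recordState f t X ⟨j.rev, by omega⟩) =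
      fun j : Fin (indexLength N) => t.testBit j := by
    funext j
    have hj := j.2
    have h1 : (j.rev : ℕ) = indexLength N - (j + 1) := Fin.val_rev j
    have h3 : (j.rev : ℕ) < indexLength N := j.rev.2
    have h4 : indexLength N - 1 - (j.rev : ℕ) = j := by omega
    simp only [recordState, h3, if_true, h4]
  unfold BasisState.queryIndex
  rw [this, Nat.ofBits_testBit, Nat.mod_eq_of_lt h2]

theorem recordState_eq_iff {N : ℕ} (f : BoolInput N → Bool) (t : ℕ) (ht : t ≤ N)
    (X Y : BoolInput N) :
    recordState f t X = recordState f t Y ↔ ∀ j : Fin N, j.1 < t → X j = Y j := by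
  constructor
  · intro h j hj
    have hjN := j.2
    have := congrFun h ⟨indexLength N + 1 + j.1, by omega⟩
    have e1 : indexLength N + 1 + j.1 - indexLength N - 1 = j.1 := by omega
    have e2 : ¬ (indexLength N + 1 + j.1 < indexLength N) := by omega
    have e3 : ¬ (indexLength N + 1 + j.1 = indexLength N) := by omega
    have e4 : ¬ (indexLength N + 1 + j.1 = indexLength N + N + 1) := by omega
    simpa only [recordState, e1, e2, e3, e4, if_false, hj, decide_true, Bool.true_and, blackBox,
      hjN, dif_pos, Fin.eta] using this
  · intro h
    funext p
    unfold recordState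
    split_ifs with h1 h2 h3
    · rfl
    · rfl
    · by_cases htN : t = N
      · have : X = Y := funext fun j => h j (by have := j.2; omega)
        rw [this]
      · simp [htN]
    · by_cases h4 : p.1 - indexLength N - 1 < t
      · have h5 : p.1 - indexLength N - 1 < N := by omega
        simp only [blackBox, h5, dif_pos, h ⟨_, h5⟩ h4]
      · simp [h4]

theorem queryMap_recordState_eq_iff {N : ℕ} (f : BoolInput N → Bool) (t : ℕ) (ht : t < N)
    (X Y : BoolInput N) :
    queryMap (N + 1) X (recordState f t X) = queryMap (N + 1) Y (recordState f t Y) ↔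
      ∀ j : Fin N, j.1 < t + 1 → X j = Y j := by
  have hT : ∀ Z : BoolInput N, recordState f t Z (targetPos N (N + 1)) = false := by
    intro Z; simp [recordState, targetPos]
  have hq : ∀ Z : BoolInput N, queryMap (N + 1) Z (recordState f t Z) =
      Function.update (recordState f t Z) (targetPos N (N + 1)) (Z ⟨t, ht⟩) := by
    intro Z
    rw [queryMap, recordState_queryIndex f t ht, hT]
    simp [blackBox, ht]
  rw [hq, hq]
  have hsplit : (∀ j : Fin N, j.1 < t + 1 → X j = Y j) ↔
      (∀ j : Fin N, j.1 < t → X j = Y j) ∧ X ⟨t, ht⟩ = Y ⟨t, ht⟩ := by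
    constructor
    · exact fun h => ⟨fun j hj => h j (by omega), h _ (by simp)⟩
    · rintro ⟨h1, h2⟩ j hj
      rcases Nat.lt_succ_iff_lt_or_eq.1 hj with h | h
      · exact h1 j h
      · have : j = ⟨t, ht⟩ := Fin.ext h
        rw [this, h2]
  rw [hsplit, ← recordState_eq_iff f t ht.le]
  constructor
  · intro h
    refine ⟨funext fun p => ?_, ?_⟩
    · by_cases hp : p = targetPos N (N + 1)
      · rw [hp, hT, hT]
      · simpa [Function.update_of_ne hp] using congrFun h p
    · simpa using congrFun h (targetPos N (N + 1))
  · rintro ⟨h1, h2⟩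
    rw [h1, h2]

theorem exists_network_computesBoundedError {N : ℕ} (f : BoolInput N → Bool) :
    ∃ (T : ℕ) (𝒩 : QuantumNetwork N T), 𝒩.ComputesBoundedError f := by
  obtain ⟨σ₀, hσ₀⟩ := exists_perm_apply_eq
    (fun _ : BoolInput N => (fun _ => false : BasisState N (N + 1))) (recordState f 0)
    (fun X Y => by rw [recordState_eq_iff f 0 (Nat.zero_le _)]; simp)
  have hstep : ∀ t : Fin N, ∃ σ : Equiv.Perm (BasisState N (N + 1)), ∀ X,
      σ (queryMap (N + 1) X (recordState f t X)) = recordState f (t + 1) X := fun t =>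
    exists_perm_apply_eq (fun X => queryMap (N + 1) X (recordState f t X)) _
      (fun X Y => by
        rw [queryMap_recordState_eq_iff f t t.2, recordState_eq_iff f (t + 1) t.2])
  choose σ hσ using hstep
  let τ : Fin (N + 1) → Equiv.Perm (BasisState N (N + 1)) := Fin.cons σ₀ σ
  let 𝒩 : QuantumNetwork N N :=
    ⟨N + 1, fun t => ⟨basisPermMatrix (τ t), basisPermMatrix_mem_unitaryGroup _⟩⟩
  have hstate : ∀ (X : BoolInput N) (t : Fin (N + 1)),
      𝒩.stateAt X t = Pi.single (recordState f t X) 1 := by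
    intro X t
    induction t using Fin.induction with
    | zero =>
      have h0 : τ 0 = σ₀ := rfl
      change (basisPermMatrix (τ 0)).mulVec (Pi.single _ 1) = _
      rw [basisPermMatrix_mulVec_single, h0, hσ₀ X]
      rfl
    | succ t ih =>
      have h1 : 𝒩.stateAt X t.succ = (basisPermMatrix (τ t.succ)).mulVec
          ((queryMatrix (N + 1) X).mulVec (𝒩.stateAt X t.castSucc)) := rfl
      have h2 : τ t.succ = σ t := rfl
      rw [h1, ih, queryMatrix_eq_basisPermMatrix, basisPermMatrix_mulVec_single,
        basisPermMatrix_mulVec_single, h2]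
      exact congrArg (fun s => Pi.single s (1 : ℂ)) (hσ t X)
  refine ⟨N, 𝒩, fun X => ?_⟩
  have hlast : recordState f N X (Fin.last (indexLength N + (N + 1))) = f X := by
    simp [recordState, Nat.add_assoc]
  have hprob : 𝒩.outputProb X (f X) = 1 := by
    unfold QuantumNetwork.outputProb QuantumNetwork.finalState
    rw [hstate, Finset.sum_eq_single (recordState f N X)]
    · rw [if_pos hlast]
      simp
    · intro s _ hs
      simp [hs]
    · simp
  rw [hprob]
  norm_num

/-! ### Block sensitivity and certificates -/

/-! The link between the two models is block sensitivity: the largest number `b` of disjoint blocks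
of variables, each of which changes `f` when flipped on some input.

Quantum side, `IsSensitiveFamily.card_le_of_computesBoundedError`: fix disjoint sensitive blocks on
`X` and flip each independently with probability `p`. Amplitudes after `T` queries have degree at
most `T` in the block indicators, so the expected probability of the output `!f X` is a polynomial
`P` in `p` of degree at most `2T`. It is an average of probabilities, so it lies in `[0, 1]` on the
whole interval, not merely at sample points, and Markov's inequality gives `P'(0) ≤ (2T)²`. But
`P'(0)` is the sum of the changes caused by flipping single blocks, each at least `1/3`. Hence `b ≤
12T²`.

Deterministic side, `exists_decisionTree_of_blockSensitivity_le`: certificates of size `b²` exist,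
and querying certificates of consistent 1-inputs settles `f` within `b` rounds. The depth is at most
`b³ ≤ 1728T⁶`. -/

/-- The input obtained from `X` by flipping the variables in `B`. -/
def flipBlock {N : ℕ} (X : BoolInput N) (B : Finset (Fin N)) : BoolInput N :=
  fun i => xor (X i) (decide (i ∈ B))

theorem flipBlock_apply_of_mem {N : ℕ} (X : BoolInput N) {B : Finset (Fin N)} {i : Fin N}
    (h : i ∈ B) : flipBlock X B i = !X i := by
  simp [flipBlock, h]

theorem flipBlock_apply_of_notMem {N : ℕ} (X : BoolInput N) {B : Finset (Fin N)} {i : Fin N}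
    (h : i ∉ B) : flipBlock X B i = X i := by
  simp [flipBlock, h]

@[simp]
theorem flipBlock_empty {N : ℕ} (X : BoolInput N) : flipBlock X ∅ = X := by
  funext i
  simp [flipBlock]

theorem flipBlock_filter_ne {N : ℕ} (X Y : BoolInput N) :
    flipBlock X {i | X i ≠ Y i} = Y := by
  funext i
  by_cases h : X i = Y i
  · simp [flipBlock, h]
  · cases hX : X i <;> cases hY : Y i <;> simp_all [flipBlock]

theorem flipBlock_flipBlock_singleton {N : ℕ} (X : BoolInput N) {B : Finset (Fin N)} {i : Fin N}
    (h : i ∈ B) : flipBlock (flipBlock X B) {i} = flipBlock X (B.erase i) := by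
  funext j
  by_cases hj : j = i
  · subst hj; simp [flipBlock, h]
  · simp [flipBlock, hj]

/-- The members of `𝓑` are disjoint blocks to which `f` is sensitive on the input `X`. -/
structure IsSensitiveFamily {N : ℕ} (f : BoolInput N → Bool) (X : BoolInput N)
    (𝓑 : Finset (Finset (Fin N))) : Prop where
  disjoint : (𝓑 : Set (Finset (Fin N))).PairwiseDisjoint id
  sensitive : ∀ B ∈ 𝓑, f (flipBlock X B) ≠ f X

/-- The cardinality grows because a sensitive block is nonempty, so it cannot be disjoint from
itself and is not yet in the family. -/
theorem IsSensitiveFamily.insert {N : ℕ} {f : BoolInput N → Bool} {X : BoolInput N}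
    {𝓑 : Finset (Finset (Fin N))} (h : IsSensitiveFamily f X 𝓑) {B : Finset (Fin N)}
    (hB : f (flipBlock X B) ≠ f X) (hd : ∀ B' ∈ 𝓑, Disjoint B B') :
    IsSensitiveFamily f X (insert B 𝓑) ∧ (insert B 𝓑).card = 𝓑.card + 1 := by
  have hne : B ≠ ∅ := by
    rintro rfl
    simp at hB
  refine ⟨⟨?_, ?_⟩, Finset.card_insert_of_notMem fun hmem => ?_⟩
  · rw [Finset.coe_insert]
    exact h.disjoint.insert fun B' hB' _ => hd B' hB'
  · intro B' hB'
    rcases Finset.mem_insert.1 hB' with rfl | h'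
    · exact hB
    · exact h.sensitive B' h'
  · exact hne (disjoint_self.1 (hd B hmem))

/-- A block that is minimal among those to which `f` is sensitive on `X` consists of variables
to which `f` is sensitive on the flipped input. -/
theorem card_le_of_minimal_sensitive {N b : ℕ} {f : BoolInput N → Bool}
    (hb : ∀ X 𝓑, IsSensitiveFamily f X 𝓑 → 𝓑.card ≤ b) {X : BoolInput N} {B : Finset (Fin N)}
    (hB : Minimal (fun B => f (flipBlock X B) ≠ f X) B) : B.card ≤ b := by
  -- Each singleton of `B` is a sensitive block on the flipped input: undoing the flip at `i` leaves
  -- `B.erase i`, which by minimality no longer changes `f`.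
  have h := hb (flipBlock X B) (B.map ⟨fun i => {i}, Finset.singleton_injective⟩) ?_
  · simpa using h
  constructor
  · intro C hC D hD hCD
    simp only [Finset.coe_map, Function.Embedding.coeFn_mk, Set.mem_image] at hC hD
    obtain ⟨i, -, rfl⟩ := hC
    obtain ⟨j, -, rfl⟩ := hD
    simpa [Function.onFun, Finset.disjoint_singleton, eq_comm] using hCD
  · intro C hC
    simp only [Finset.mem_map, Function.Embedding.coeFn_mk] at hC
    obtain ⟨i, hi, rfl⟩ := hC
    rw [flipBlock_flipBlock_singleton X hi]
    have := hB.not_prop_of_lt (Finset.erase_ssubset hi)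
    rw [not_not] at this
    rw [this]
    exact hB.prop.symm

/-- Every input has a certificate whose size is at most the square of the block sensitivity. -/
theorem exists_certificate {N b : ℕ} {f : BoolInput N → Bool}
    (hb : ∀ X 𝓑, IsSensitiveFamily f X 𝓑 → 𝓑.card ≤ b) (X : BoolInput N) :
    ∃ S : Finset (Fin N), S.card ≤ b * b ∧ ∀ Y : BoolInput N, (∀ i ∈ S, Y i = X i) → f Y = f X := by
  let P : Finset (Finset (Fin N)) → Prop := fun 𝓑 =>
    IsSensitiveFamily f X 𝓑 ∧ ∀ B ∈ 𝓑, Minimal (fun B => f (flipBlock X B) ≠ f X) B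
  have hP : ∃ 𝓑, P 𝓑 := ⟨∅, ⟨by simp, by simp⟩, by simp⟩
  -- The certificate is the union of a maximal disjoint family of minimal sensitive blocks: at most
  -- `b` blocks with at most `b` variables each.
  obtain ⟨𝓑, h𝓑⟩ := (Set.toFinite {𝓑 | P 𝓑}).exists_maximal hP
  refine ⟨𝓑.biUnion id, ?_, fun Y hY => ?_⟩
  · exact (Finset.card_biUnion_le_card_mul _ _ b fun B hB =>
      card_le_of_minimal_sensitive hb (h𝓑.prop.2 B hB)).trans
        (Nat.mul_le_mul_right b (hb X 𝓑 h𝓑.prop.1))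
  · by_contra hne
    have hD : f (flipBlock X {i | X i ≠ Y i}) ≠ f X := by rwa [flipBlock_filter_ne]
    -- The set where `Y` differs from `X` is sensitive and avoids the union; a minimal sensitive
    -- block inside it would enlarge the maximal family.
    obtain ⟨B, hBle, hB⟩ := (Set.toFinite {B | f (flipBlock X B) ≠ f X}).exists_le_minimal hD
    have hdisj : ∀ B' ∈ 𝓑, Disjoint B B' := by
      intro B' hB'
      rw [Finset.disjoint_left]
      intro i hi hi'
      have h1 := hBle hi
      simp only [Finset.mem_filter, Finset.mem_univ, true_and] at h1
      exact h1 (hY i (Finset.mem_biUnion.2 ⟨B', hB', hi'⟩)).symm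
    obtain ⟨h1, h2⟩ := h𝓑.prop.1.insert hB.prop hdisj
    have h3 : P (insert B 𝓑) := ⟨h1, fun B' hB' => by
      rcases Finset.mem_insert.1 hB' with rfl | h'
      · exact hB
      · exact h𝓑.prop.2 B' h'⟩
    have h4 := Finset.card_le_card (h𝓑.le_of_ge h3 (Finset.subset_insert B 𝓑))
    omega

/-! ### Decision trees from certificates -/

/-- A decision tree may first query all variables in `S` and then continue, on inputs that agree
with `X₀` on `Q`. -/
theorem exists_decisionTree_of_query {N : ℕ} (f : BoolInput N → Bool) (d : ℕ)
    (S : Finset (Fin N)) : ∀ (Q : Finset (Fin N)) (X₀ : BoolInput N),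
    (∀ Z : BoolInput N, (∀ i ∈ Q, Z i = X₀ i) → ∃ t : DecisionTree N, t.depth ≤ d ∧
      ∀ X : BoolInput N, (∀ i ∈ Q ∪ S, X i = Z i) → t.eval X = f X) →
    ∃ t : DecisionTree N, t.depth ≤ S.card + d ∧
      ∀ X : BoolInput N, (∀ i ∈ Q, X i = X₀ i) → t.eval X = f X := by
  induction S using Finset.induction_on with
  | empty =>
    intro Q X₀ h
    simpa using h X₀ fun _ _ => rfl
  | insert a S ha ih =>
    intro Q X₀ h
    by_cases haQ : a ∈ Q
    · have hQ : Q ∪ insert a S = Q ∪ S := by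
        rw [Finset.union_insert, Finset.insert_eq_of_mem (Finset.mem_union_left _ haQ)]
      rw [hQ] at h
      obtain ⟨t, ht, ht'⟩ := ih Q X₀ h
      exact ⟨t, ht.trans (by rw [Finset.card_insert_of_notMem ha]; omega), ht'⟩
    · have key : ∀ c : Bool, ∃ t : DecisionTree N, t.depth ≤ S.card + d ∧
          ∀ X : BoolInput N, (∀ i ∈ Q, X i = X₀ i) → X a = c → t.eval X = f X := by
        intro c
        obtain ⟨t, ht, ht'⟩ := ih (insert a Q) (Function.update X₀ a c) fun Z hZ => by
          have := h Z fun i hi => by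
            rw [hZ i (Finset.mem_insert_of_mem hi), Function.update_of_ne]
            rintro rfl
            exact haQ hi
          rwa [Finset.union_insert, ← Finset.insert_union] at this
        refine ⟨t, ht, fun X hX hXa => ht' X fun i hi => ?_⟩
        by_cases hia : i = a
        · subst hia; simpa using hXa
        · rw [Function.update_of_ne hia]
          exact hX i ((Finset.mem_insert.1 hi).resolve_left hia)
      obtain ⟨t₀, h₀, h₀'⟩ := key false
      obtain ⟨t₁, h₁, h₁'⟩ := key true
      refine ⟨.node a t₀ t₁, ?_, fun X hX => ?_⟩
      · rw [Finset.card_insert_of_notMem ha, DecisionTree.depth]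
        have := max_le h₀ h₁
        omega
      · rw [DecisionTree.eval]
        cases hXa : X a
        · simpa using h₀' X hX hXa
        · simpa using h₁' X hX hXa

/-- Querying certificates of inputs with value `1` that are consistent with the answers so far:
every round adds a block to a family that is sensitive for all consistent inputs with value `0`. -/
theorem exists_decisionTree_of_rounds {N b m : ℕ} {f : BoolInput N → Bool}
    (hb : ∀ X 𝓑, IsSensitiveFamily f X 𝓑 → 𝓑.card ≤ b)
    (hm : ∀ X : BoolInput N, ∃ S : Finset (Fin N), S.card ≤ m ∧
      ∀ Y : BoolInput N, (∀ i ∈ S, Y i = X i) → f Y = f X) (k : ℕ) :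
    ∀ (Q : Finset (Fin N)) (X₀ : BoolInput N) (𝓑 : Finset (Finset (Fin N))),
    (∀ B ∈ 𝓑, B ⊆ Q) → b ≤ 𝓑.card + k →
    (∀ Y : BoolInput N, (∀ i ∈ Q, Y i = X₀ i) → f Y = false → IsSensitiveFamily f Y 𝓑) →
    ∃ t : DecisionTree N, t.depth ≤ k * m ∧
      ∀ X : BoolInput N, (∀ i ∈ Q, X i = X₀ i) → t.eval X = f X := by
  induction k with
  | zero =>
    intro Q X₀ 𝓑 hQ hk hs
    by_cases h0 : ∃ Y : BoolInput N, (∀ i ∈ Q, Y i = X₀ i) ∧ f Y = false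
    · obtain ⟨Y, hY, hfY⟩ := h0
      refine ⟨.leaf false, by simp [DecisionTree.depth], fun X hX => ?_⟩
      by_contra hne
      -- The family already has `b` members, all inside `Q`. A consistent 1-input would differ from
      -- `Y` in one more sensitive block outside `Q`, exceeding the bound.
      obtain ⟨h1, h2⟩ := (hs Y hY hfY).insert (B := {i | Y i ≠ X i})
        (by
          rw [flipBlock_filter_ne, hfY]
          intro h
          simp [DecisionTree.eval, h] at hne)
        (fun B' hB' => by
          rw [Finset.disjoint_left]
          intro i hi hi'
          simp only [Finset.mem_filter, Finset.mem_univ, true_and] at hi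
          have := hQ B' hB' hi'
          exact hi ((hY i this).trans (hX i this).symm))
      have := hb Y _ h1
      omega
    · push Not at h0
      exact ⟨.leaf true, by simp [DecisionTree.depth], fun X hX => by
        have := h0 X hX
        rw [DecisionTree.eval]
        revert this
        cases f X <;> decide⟩
  | succ k ih =>
    intro Q X₀ 𝓑 hQ hk hs
    by_cases h1 : ∃ Y : BoolInput N, (∀ i ∈ Q, Y i = X₀ i) ∧ f Y = true
    swap
    · push Not at h1
      exact ⟨.leaf false, by simp [DecisionTree.depth], fun X hX => by
        have := h1 X hX
        rw [DecisionTree.eval]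
        revert this
        cases f X <;> decide⟩
    obtain ⟨Y₁, hY₁, hfY₁⟩ := h1
    obtain ⟨S, hS, hcert⟩ := hm Y₁
    obtain ⟨t, ht, ht'⟩ := exists_decisionTree_of_query f (k * m) S Q X₀ fun Z hZ => by
      by_cases hZS : ∀ i ∈ S, Z i = Y₁ i
      · refine ⟨.leaf true, by simp [DecisionTree.depth], fun X hX => ?_⟩
        rw [DecisionTree.eval, ← hfY₁]
        exact (hcert X fun i hi =>
          (hX i (Finset.mem_union_right _ hi)).trans (hZS i hi)).symm
      · push Not at hZS
        obtain ⟨i₀, hi₀, hne⟩ := hZS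
        -- `B` is where the answers contradict the certificate. It misses `Q`, since `Z` and `Y₁`
        -- both agree with `X₀` there, and it depends only on the answers, so it serves every
        -- consistent 0-input at once.
        let B : Finset (Fin N) := S.filter fun i => Z i ≠ Y₁ i
        have hBQ : Disjoint B Q := by
          rw [Finset.disjoint_left]
          intro i hi hi'
          exact (Finset.mem_filter.1 hi).2 ((hZ i hi').trans (hY₁ i hi').symm)
        have hBd : ∀ B' ∈ 𝓑, Disjoint B B' := fun B' hB' => hBQ.mono_right (hQ B' hB')
        have hB𝓑 : B ∉ 𝓑 := by
          intro hB
          exact Finset.disjoint_left.1 (hBd B hB) (Finset.mem_filter.2 ⟨hi₀, hne⟩)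
            (Finset.mem_filter.2 ⟨hi₀, hne⟩)
        refine ih (Q ∪ S) Z (insert B 𝓑) ?_ ?_ ?_
        · intro B' hB'
          rcases Finset.mem_insert.1 hB' with rfl | h'
          · exact (Finset.filter_subset _ _).trans Finset.subset_union_right
          · exact (hQ B' h').trans Finset.subset_union_left
        · rw [Finset.card_insert_of_notMem hB𝓑]
          omega
        · intro Y hY hfY
          refine ((hs Y (fun i hi =>
            (hY i (Finset.mem_union_left _ hi)).trans (hZ i hi)) hfY).insert ?_ hBd).1
          -- Flipping `B` makes `Y` agree with `Y₁` on all of `S`, so the certificate forces the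
          -- value `1`.
          have : f (flipBlock Y B) = true := by
            rw [← hfY₁]
            refine hcert _ fun i hi => ?_
            have hYi := hY i (Finset.mem_union_right _ hi)
            by_cases hZi : Z i = Y₁ i
            · rw [flipBlock_apply_of_notMem _ (by simp [B, hZi]), hYi, hZi]
            · rw [flipBlock_apply_of_mem _ (by simp [B, hZi, hi]), hYi]
              cases hz : Z i <;> cases hy : Y₁ i <;> simp_all
          rw [this, hfY]
          decide
    exact ⟨t, ht.trans (by rw [Nat.succ_mul]; omega), ht'⟩

/-- The decision tree complexity is at most the third power of the block sensitivity. -/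
theorem exists_decisionTree_of_blockSensitivity_le {N b : ℕ} {f : BoolInput N → Bool}
    (hb : ∀ X 𝓑, IsSensitiveFamily f X 𝓑 → 𝓑.card ≤ b) :
    ∃ t : DecisionTree N, t.Computes f ∧ t.depth ≤ b * (b * b) := by
  obtain ⟨t, ht, ht'⟩ := exists_decisionTree_of_rounds hb (exists_certificate hb) b ∅
    (fun _ => false) ∅ (by simp) (by simp) fun Y _ _ => ⟨by simp, by simp⟩
  exact ⟨t, fun X => ht' X (by simp), ht⟩

/-! ### Polynomials on the cube and their Bernoulli averages -/

/-- The functions on the subsets of `ι` that are polynomials of degree at most `d` in the indicator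
variables. -/
def cubePoly (ι : Type*) (d : ℕ) : Submodule ℂ (Finset ι → ℂ) :=
  Submodule.span ℂ {g | ∃ S : Finset ι, S.card ≤ d ∧ g = Set.indicator {J | S ⊆ J} 1}

section CubePoly

variable {ι : Type*} {d e : ℕ}

theorem cubePoly_mono (h : d ≤ e) : cubePoly ι d ≤ cubePoly ι e :=
  Submodule.span_mono fun _ ⟨S, hS, hg⟩ => ⟨S, hS.trans h, hg⟩

theorem const_mem_cubePoly (c : ℂ) (d : ℕ) : (fun _ => c) ∈ cubePoly ι d := by
  have h : Set.indicator {J : Finset ι | ∅ ⊆ J} (1 : Finset ι → ℂ) ∈ cubePoly ι d :=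
    Submodule.subset_span ⟨∅, by simp, rfl⟩
  convert Submodule.smul_mem _ c h using 1
  funext J
  simp

/-- On generators, containing both `S` and `S'` means containing `S ∪ S'`, whose size is at most the
sum. -/
theorem mul_mem_cubePoly [DecidableEq ι] {g h : Finset ι → ℂ} (hg : g ∈ cubePoly ι d)
    (hh : h ∈ cubePoly ι e) : g * h ∈ cubePoly ι (d + e) := by
  have := Submodule.mul_mem_mul hg hh
  rw [cubePoly, cubePoly, Submodule.span_mul_span] at this
  refine Submodule.span_mono ?_ this
  rintro _ ⟨_, ⟨S, hS, rfl⟩, _, ⟨S', hS', rfl⟩, rfl⟩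
  refine ⟨S ∪ S', (Finset.card_union_le S S').trans (Nat.add_le_add hS hS'), ?_⟩
  funext J
  by_cases h1 : S ⊆ J <;> by_cases h2 : S' ⊆ J <;> simp [Finset.union_subset_iff, h1, h2]

theorem star_mem_cubePoly {g : Finset ι → ℂ} (hg : g ∈ cubePoly ι d) :
    star g ∈ cubePoly ι d := by
  induction hg using Submodule.span_induction with
  | mem g hg =>
    obtain ⟨S, hS, rfl⟩ := hg
    refine Submodule.subset_span ⟨S, hS, ?_⟩
    funext J
    by_cases h : S ⊆ J <;> simp [h]
  | zero => simp
  | add g h _ _ hg hh => rw [star_add]; exact Submodule.add_mem _ hg hh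
  | smul c g _ hg => rw [star_smul]; exact Submodule.smul_mem _ _ hg

theorem indicator_mem_cubePoly [DecidableEq ι] (j : ι) :
    (fun J => if j ∈ J then 1 else 0) ∈ cubePoly ι 1 := by
  refine Submodule.subset_span ⟨{j}, by simp, ?_⟩
  funext J
  simp [Set.indicator_apply]

end CubePoly

open Polynomial in
/-- The expectation of `g J`, where `J` contains every element of `ι` independently with probability
`X`, as a polynomial in `X`. -/
noncomputable def bernoulliPoly {ι R : Type*} [Fintype ι] [CommRing R] (g : Finset ι → R) : R[X] :=
  ∑ J : Finset ι, C (g J) * (X ^ J.card * (1 - X) ^ (Fintype.card ι - J.card))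

section BernoulliPoly

open Polynomial

variable {ι : Type*} [Fintype ι]

theorem map_bernoulliPoly {R S : Type*} [CommRing R] [CommRing S] (φ : R →+* S)
    (g : Finset ι → R) : (bernoulliPoly g).map φ = bernoulliPoly (φ ∘ g) := by
  simp [bernoulliPoly, Polynomial.map_sum]

/-- By independence, all of `S` is chosen with probability `X ^ S.card`. This is why averaging does
not raise the degree. -/
theorem bernoulliPoly_indicator [DecidableEq ι] (S : Finset ι) :
    bernoulliPoly (Set.indicator {J | S ⊆ J} (1 : Finset ι → ℂ)) = X ^ S.card := by
  -- In the expansion over subsets `J`, the factor `0` at elements of `S` kills every `J` that omits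
  -- one of them; off `S` the two summands add up to `1`.
  have h := Fintype.prod_add (fun _ : ι => (X : ℂ[X])) (fun i => if i ∈ S then 0 else 1 - X)
  have h1 : ∀ i : ι, (X + if i ∈ S then 0 else 1 - X : ℂ[X]) = if i ∈ S then X else 1 := by
    intro i
    split_ifs <;> ring
  simp only [h1, Finset.prod_ite_mem, Finset.univ_inter, Finset.prod_const] at h
  rw [h, bernoulliPoly]
  refine Finset.sum_congr rfl fun J _ => ?_
  by_cases hJ : S ⊆ J
  · have h2 : ∀ i ∈ Jᶜ, (if i ∈ S then 0 else 1 - X : ℂ[X]) = 1 - X := fun i hi =>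
      if_neg fun hiS => Finset.mem_compl.1 hi (hJ hiS)
    rw [Finset.prod_congr rfl h2, Finset.prod_const, Finset.card_compl]
    simp [hJ]
  · obtain ⟨i, hiS, hiJ⟩ := Finset.not_subset.1 hJ
    rw [Finset.prod_eq_zero (Finset.mem_compl.2 hiJ) (by simp [hiS])]
    simp [hJ]

theorem degree_bernoulliPoly_le {d : ℕ} {g : Finset ι → ℂ} (hg : g ∈ cubePoly ι d) :
    (bernoulliPoly g).degree ≤ d := by
  classical
  rw [← mem_degreeLE]
  induction hg using Submodule.span_induction with
  | mem g hg =>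
    obtain ⟨S, hS, rfl⟩ := hg
    rw [bernoulliPoly_indicator, mem_degreeLE, degree_X_pow]
    exact_mod_cast hS
  | zero => simp [bernoulliPoly]
  | add g h _ _ hg hh =>
    convert Submodule.add_mem _ hg hh using 1
    simp [bernoulliPoly, add_mul, Finset.sum_add_distrib]
  | smul c g _ hg =>
    convert Submodule.smul_mem _ c hg using 1
    simp [bernoulliPoly, Finset.smul_sum, smul_eq_C_mul, mul_assoc]

theorem eval_bernoulliPoly (g : Finset ι → ℝ) (p : ℝ) :
    (bernoulliPoly g).eval p =
      ∑ J : Finset ι, g J * (p ^ J.card * (1 - p) ^ (Fintype.card ι - J.card)) := by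
  simp [bernoulliPoly, eval_finsetSum]

theorem eval_bernoulliPoly_mem_Icc {g : Finset ι → ℝ} (hg : ∀ J, g J ∈ Set.Icc (0 : ℝ) 1) {p : ℝ}
    (hp : p ∈ Set.Icc (0 : ℝ) 1) : (bernoulliPoly g).eval p ∈ Set.Icc (0 : ℝ) 1 := by
  have hw : ∀ J : Finset ι, 0 ≤ p ^ J.card * (1 - p) ^ (Fintype.card ι - J.card) := fun J =>
    mul_nonneg (pow_nonneg hp.1 _) (pow_nonneg (sub_nonneg.2 hp.2) _)
  rw [eval_bernoulliPoly]
  refine ⟨Finset.sum_nonneg fun J _ => mul_nonneg (hg J).1 (hw J), ?_⟩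
  calc _ ≤ ∑ J : Finset ι, p ^ J.card * (1 - p) ^ (Fintype.card ι - J.card) :=
        Finset.sum_le_sum fun J _ => mul_le_of_le_one_left (hw J) (hg J).2
    _ = 1 := by rw [Fintype.sum_pow_mul_eq_add_pow]; simp

/-- To first order at `0` only sets with at most one element matter: the empty set contributes `-n *
g ∅`, with `n` the size of `ι`, and each singleton `{j}` contributes `g {j}`. -/
theorem eval_zero_derivative_bernoulliPoly (g : Finset ι → ℝ) :
    (derivative (bernoulliPoly g)).eval 0 = ∑ j : ι, (g {j} - g ∅) := by
  classical
  have h : ∀ J : Finset ι, (derivative (C (g J) *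
      (X ^ J.card * (1 - X) ^ (Fintype.card ι - J.card)))).eval 0 =
      (if J = ∅ then -(Fintype.card ι * g ∅) else 0) +
        (if J ∈ Finset.powersetCard 1 Finset.univ then g J else 0) := by
    intro J
    simp only [derivative_mul, derivative_C, derivative_pow, derivative_sub,
      derivative_one, derivative_X, Finset.mem_powersetCard_univ]
    rcases J.eq_empty_or_nonempty with rfl | hJ
    · simp [mul_comm]
    · have h0 : J.card ≠ 0 := Finset.card_ne_zero.2 hJ
      by_cases h1 : J.card = 1
      · simp [h1, hJ.ne_empty]
      · have h2 : J.card - 1 ≠ 0 := by omega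
        simp [h1, h0, h2, hJ.ne_empty]
  rw [bernoulliPoly, derivative_sum, eval_finsetSum, Finset.sum_congr rfl fun J _ => h J,
    Finset.sum_add_distrib, Finset.sum_ite_eq', Finset.sum_ite_mem, Finset.univ_inter,
    Finset.powersetCard_one, Finset.sum_map, Finset.sum_sub_distrib]
  simp
  ring

end BernoulliPoly

open Polynomial in
/-- Markov's inequality at an end point, for polynomials with values in `[0, 1]`. -/
theorem eval_zero_derivative_le_sq {d : ℕ} {P : ℝ[X]} (hd : P.degree ≤ d)
    (hP : ∀ p ∈ Set.Icc (0 : ℝ) 1, P.eval p ∈ Set.Icc (0 : ℝ) 1) :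
    (derivative P).eval 0 ≤ (d : ℝ) ^ 2 := by
  -- `ℓ` maps `[-1, 1]` onto `[0, 1]` and sends `1` to `0`. The scaling in `q` gives values in `[-1,
  -- 1]` and `q'(1) = P'(0)`.
  let ℓ : ℝ[X] := C (1 / 2) - C (1 / 2) * X
  let q : ℝ[X] := 1 - C 2 * P.comp ℓ
  have hℓ : ℓ.natDegree ≤ 1 := by
    dsimp only [ℓ]
    compute_degree
  have hq : q.degree ≤ d := by
    refine natDegree_le_iff_degree_le.1 ?_
    refine (natDegree_sub_le _ _).trans (max_le (by simp) ?_)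
    refine (natDegree_C_mul_le _ _).trans (natDegree_comp_le.trans ?_)
    exact (Nat.mul_le_mul (natDegree_le_iff_degree_le.2 hd) hℓ).trans (by simp)
  have hbnd : ∀ x ∈ Set.Icc (-1 : ℝ) 1, |q.eval x| ≤ 1 := by
    intro x hx
    have h := hP (1 / 2 - 1 / 2 * x) ⟨by linarith [hx.2], by linarith [hx.1]⟩
    simp only [q, ℓ, eval_sub, eval_one, eval_mul, eval_C, eval_comp, eval_X]
    rw [abs_le]
    constructor <;> linarith [h.1, h.2]
  -- Among such polynomials the Chebyshev polynomial has the largest derivative at `1`, namely `d²`.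
  have h := Polynomial.Chebyshev.eval_iterate_derivative_le_of_forall_abs_le_one (k := 1)
    le_rfl hq hbnd
  simpa [q, ℓ, derivative_comp, Polynomial.Chebyshev.T_derivative_eq_U, sq] using h

/-! ### Output probabilities as polynomials -/

theorem queryMatrix_mulVec_apply {N w : ℕ} (X : BoolInput N) (ψ : BasisState N w → ℂ)
    (s : BasisState N w) : (queryMatrix w X).mulVec ψ s = ψ (queryMap w X s) := by
  have h : ∀ s', s = queryMap w X s' ↔ s' = queryMap w X s := fun s' =>
    ⟨fun h => by rw [h, queryMap_involutive], fun h => by rw [h, queryMap_involutive]⟩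
  simp [queryMatrix, Matrix.mulVec, dotProduct, h]

theorem star_dotProduct_mulVec_of_mem_unitaryGroup {β : Type*} [Fintype β] [DecidableEq β]
    {U : Matrix β β ℂ} (hU : U ∈ Matrix.unitaryGroup β ℂ) (v : β → ℂ) :
    star (U.mulVec v) ⬝ᵥ U.mulVec v = star v ⬝ᵥ v := by
  rw [Matrix.star_mulVec, Matrix.dotProduct_mulVec, Matrix.vecMul_vecMul,
    ← Matrix.star_eq_conjTranspose, Matrix.mem_unitaryGroup_iff'.1 hU, Matrix.vecMul_one]

namespace QuantumNetwork

variable {N T : ℕ}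

theorem stateAt_succ (𝒩 : QuantumNetwork N T) (X : BoolInput N) (t : Fin T) :
    𝒩.stateAt X t.succ =
      (𝒩.U t.succ).1.mulVec ((queryMatrix 𝒩.w X).mulVec (𝒩.stateAt X t.castSucc)) := rfl

theorem star_stateAt_dotProduct_stateAt (𝒩 : QuantumNetwork N T) (X : BoolInput N)
    (t : Fin (T + 1)) : star (𝒩.stateAt X t) ⬝ᵥ 𝒩.stateAt X t = 1 := by
  induction t using Fin.induction with
  | zero =>
    change star ((𝒩.U 0).1.mulVec 𝒩.initialState) ⬝ᵥ (𝒩.U 0).1.mulVec 𝒩.initialState = 1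
    rw [star_dotProduct_mulVec_of_mem_unitaryGroup (𝒩.U 0).2]
    simp [initialState]
  | succ t ih =>
    rw [stateAt_succ, star_dotProduct_mulVec_of_mem_unitaryGroup (𝒩.U t.succ).2,
      star_dotProduct_mulVec_of_mem_unitaryGroup (queryMatrix_mem_unitaryGroup 𝒩.w X), ih]

theorem outputProb_nonneg (𝒩 : QuantumNetwork N T) (X : BoolInput N) (b : Bool) :
    0 ≤ 𝒩.outputProb X b :=
  Finset.sum_nonneg fun s _ => by split_ifs <;> positivity

theorem outputProb_add_outputProb_not (𝒩 : QuantumNetwork N T) (X : BoolInput N) (b : Bool) :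
    𝒩.outputProb X b + 𝒩.outputProb X (!b) = 1 := by
  have h := 𝒩.star_stateAt_dotProduct_stateAt X (Fin.last T)
  have h' : ∑ s, ‖𝒩.finalState X s‖ ^ 2 = 1 := by
    apply Complex.ofReal_injective
    rw [Complex.ofReal_one, ← h]
    simp [dotProduct, finalState, Complex.conj_mul']
  rw [outputProb, outputProb, ← Finset.sum_add_distrib, ← h']
  refine Finset.sum_congr rfl fun s _ => ?_
  cases b <;> cases s (Fin.last (indexLength N + 𝒩.w)) <;> simp

variable {ι : Type*} {X : Finset ι → BoolInput N}

/-- Unitaries act linearly with constant coefficients and keep the degree. A query replaces the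
amplitude at `s` by `ψ s + (ψ s' - ψ s) * x_i`, where `s'` is `s` with its target bit flipped, so it
raises the degree by at most one. -/
theorem stateAt_mem_cubePoly (𝒩 : QuantumNetwork N T)
    (hX : ∀ i, (fun J => if X J i then (1 : ℂ) else 0) ∈ cubePoly ι 1) (t : Fin (T + 1)) :
    ∀ s, (fun J => 𝒩.stateAt (X J) t s) ∈ cubePoly ι t := by
  classical
  have hmulVec : ∀ {d : ℕ} (U : Matrix (BasisState N 𝒩.w) (BasisState N 𝒩.w) ℂ)
      (ψ : Finset ι → BasisState N 𝒩.w → ℂ), (∀ s, (fun J => ψ J s) ∈ cubePoly ι d) →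
      ∀ s, (fun J => U.mulVec (ψ J) s) ∈ cubePoly ι d := by
    intro d U ψ hψ s
    have : (fun J => U.mulVec (ψ J) s) = ∑ s', U s s' • fun J => ψ J s' := by
      funext J
      simp [Matrix.mulVec, dotProduct]
    rw [this]
    exact Submodule.sum_mem _ fun s' _ => Submodule.smul_mem _ _ (hψ s')
  induction t using Fin.induction with
  | zero => exact fun s => const_mem_cubePoly _ _
  | succ t ih =>
    refine hmulVec (𝒩.U t.succ).1
      (fun J => (queryMatrix 𝒩.w (X J)).mulVec (𝒩.stateAt (X J) t.castSucc)) fun s => ?_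
    have hbb : (fun J => if blackBox (X J) s.queryIndex then (1 : ℂ) else 0) ∈ cubePoly ι 1 := by
      by_cases hi : s.queryIndex < N
      · simpa [blackBox, hi] using hX ⟨_, hi⟩
      · simpa [blackBox, hi] using const_mem_cubePoly (ι := ι) 0 1
    let s' : BasisState N 𝒩.w :=
      Function.update s (targetPos N 𝒩.w) (xor (s (targetPos N 𝒩.w)) true)
    have h : (fun J => (queryMatrix 𝒩.w (X J)).mulVec (𝒩.stateAt (X J) t.castSucc) s) =
        (fun J => 𝒩.stateAt (X J) t.castSucc s) +
          ((fun J => 𝒩.stateAt (X J) t.castSucc s') - fun J => 𝒩.stateAt (X J) t.castSucc s) *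
            fun J => if blackBox (X J) s.queryIndex then (1 : ℂ) else 0 := by
      funext J
      rw [queryMatrix_mulVec_apply, queryMap]
      cases h : blackBox (X J) s.queryIndex <;> simp [h, s']
    rw [h, Fin.val_succ]
    exact Submodule.add_mem _ (cubePoly_mono (Nat.le_succ _) (ih s))
      (mul_mem_cubePoly (Submodule.sub_mem _ (ih s') (ih s)) hbb)

/-- A probability is a sum of products of an amplitude with its conjugate, which doubles the degree.
-/
theorem outputProb_mem_cubePoly (𝒩 : QuantumNetwork N T)
    (hX : ∀ i, (fun J => if X J i then (1 : ℂ) else 0) ∈ cubePoly ι 1) (b : Bool) :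
    (fun J => (𝒩.outputProb (X J) b : ℂ)) ∈ cubePoly ι (T + T) := by
  classical
  have h : (fun J => (𝒩.outputProb (X J) b : ℂ)) =
      ∑ s : BasisState N 𝒩.w, if s (Fin.last (indexLength N + 𝒩.w)) = b then
        star (fun J => 𝒩.finalState (X J) s) * (fun J => 𝒩.finalState (X J) s) else 0 := by
    funext J
    rw [outputProb, Complex.ofReal_sum, Finset.sum_apply]
    refine Finset.sum_congr rfl fun s _ => ?_
    split_ifs <;> simp [Complex.conj_mul']
  rw [h]
  refine Submodule.sum_mem _ fun s _ => ?_
  split_ifs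
  · have := 𝒩.stateAt_mem_cubePoly hX (Fin.last T) s
    exact mul_mem_cubePoly (star_mem_cubePoly this) this
  · exact Submodule.zero_mem _

end QuantumNetwork

/-! ### Block sensitivity and quantum queries -/

/-- Flipping a union of disjoint blocks, as a function of the set of flipped blocks. -/
theorem flipBlock_biUnion_mem_cubePoly {N : ℕ} {ι : Type*} (X : BoolInput N)
    (B : ι → Finset (Fin N)) (hB : Pairwise fun j k => Disjoint (B j) (B k)) (i : Fin N) :
    (fun J : Finset ι => if flipBlock X (J.biUnion B) i then (1 : ℂ) else 0) ∈ cubePoly ι 1 := by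
  classical
  by_cases hi : ∃ j, i ∈ B j
  · obtain ⟨j, hj⟩ := hi
    have hmem : ∀ J : Finset ι, i ∈ J.biUnion B ↔ j ∈ J := by
      intro J
      rw [Finset.mem_biUnion]
      constructor
      · rintro ⟨k, hk, hik⟩
        by_contra hjJ
        have hjk : j ≠ k := by
          rintro rfl
          exact hjJ hk
        exact Finset.disjoint_left.1 (hB hjk) hj hik
      · exact fun h => ⟨j, h, hj⟩
    have hind := indicator_mem_cubePoly j
    -- A variable lies in at most one block, so its flipped value is the indicator of that block or
    -- its complement.
    cases hXi : X i
    · convert hind using 3 with J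
      simp [flipBlock, hXi, hmem]
    · convert Submodule.sub_mem _ (const_mem_cubePoly (ι := ι) 1 1) hind using 1
      funext J
      by_cases hJ : j ∈ J <;> simp [flipBlock, hXi, hmem, hJ]
  · have hmem : ∀ J : Finset ι, i ∉ J.biUnion B := fun J h => by
      obtain ⟨k, -, hk⟩ := Finset.mem_biUnion.1 h
      exact hi ⟨k, hk⟩
    convert const_mem_cubePoly (if X i then (1 : ℂ) else 0) 1 using 2 with J
    rw [flipBlock_apply_of_notMem X (hmem J)]

/-- The block sensitivity is at most `12` times the square of the number of quantum queries. -/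
theorem IsSensitiveFamily.card_le_of_computesBoundedError {N T : ℕ} {f : BoolInput N → Bool}
    {𝒩 : QuantumNetwork N T} (h𝒩 : 𝒩.ComputesBoundedError f) {X : BoolInput N}
    {𝓑 : Finset (Finset (Fin N))} (h : IsSensitiveFamily f X 𝓑) : 𝓑.card ≤ 12 * T ^ 2 := by
  let B : 𝓑 → Finset (Fin N) := Subtype.val
  have hB : Pairwise fun j k => Disjoint (B j) (B k) := fun j k hjk =>
    h.disjoint j.2 k.2 fun e => hjk (Subtype.ext e)
  let g : Finset 𝓑 → ℝ := fun J => 𝒩.outputProb (flipBlock X (J.biUnion B)) (!f X)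
  have hg : ∀ J, g J ∈ Set.Icc (0 : ℝ) 1 := fun J =>
    ⟨𝒩.outputProb_nonneg _ _, by
      have h1 := 𝒩.outputProb_add_outputProb_not (flipBlock X (J.biUnion B)) (!f X)
      have h2 := 𝒩.outputProb_nonneg (flipBlock X (J.biUnion B)) (!(!f X))
      simp only [g]
      linarith⟩
  have hdeg : (bernoulliPoly g).degree ≤ (T + T : ℕ) := by
    -- The degree bound is over `ℂ`, where the amplitudes live; the embedding of `ℝ` preserves
    -- degrees.
    rw [← Polynomial.degree_map (bernoulliPoly g) Complex.ofRealHom, map_bernoulliPoly]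
    exact degree_bernoulliPoly_le
      (𝒩.outputProb_mem_cubePoly (flipBlock_biUnion_mem_cubePoly X B hB) _)
  have h0 : g ∅ ≤ 1 / 3 := by
    have h1 := h𝒩 X
    have h2 := 𝒩.outputProb_add_outputProb_not X (f X)
    simp only [g, Finset.biUnion_empty, flipBlock_empty]
    linarith
  have h1 : ∀ j, 2 / 3 ≤ g {j} := by
    intro j
    have h1 := h𝒩 (flipBlock X (B j))
    have h2 : f (flipBlock X (B j)) = !f X := Bool.eq_not_of_ne (h.sensitive _ j.2)
    simpa only [g, Finset.singleton_biUnion, h2] using h1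
  have h2 := eval_zero_derivative_le_sq hdeg fun p hp => eval_bernoulliPoly_mem_Icc hg hp
  rw [eval_zero_derivative_bernoulliPoly] at h2
  have h3 : (𝓑.card : ℝ) * (1 / 3) ≤ ∑ j : 𝓑, (g {j} - g ∅) := by
    have := Finset.card_nsmul_le_sum (Finset.univ : Finset 𝓑) (fun j => g {j} - g ∅) (1 / 3)
      fun j _ => by linarith [h1 j]
    simpa using this
  have h4 : (𝓑.card : ℝ) ≤ (12 * T ^ 2 : ℕ) := by
    push_cast at h2 ⊢
    linarith
  exact_mod_cast h4

theorem exists_decisionTree_of_computesBoundedError {N T : ℕ} {f : BoolInput N → Bool}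
    {𝒩 : QuantumNetwork N T} (h𝒩 : 𝒩.ComputesBoundedError f) :
    ∃ t : DecisionTree N, t.Computes f ∧ t.depth ≤ 4096 * T ^ 6 := by
  obtain ⟨t, ht, hd⟩ := exists_decisionTree_of_blockSensitivity_le
    fun X 𝓑 h => h.card_le_of_computesBoundedError h𝒩
  refine ⟨t, ht, hd.trans ?_⟩
  -- The argument yields `12³ = 1728`; the stated `4096 = 16³` leaves slack.
  calc 12 * T ^ 2 * (12 * T ^ 2 * (12 * T ^ 2)) = 1728 * T ^ 6 := by ring
    _ ≤ 4096 * T ^ 6 := Nat.mul_le_mul_right _ (by norm_num)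

theorem mainTheorem1 (N : ℕ) (f : (Fin N → Bool) → Bool) :
    decisionTreeComplexity f ≤ 4096 * boundedErrorQuantumComplexity f ^ 6 ∧
    ∀ (T : ℕ) (𝒩 : QuantumNetwork N T), 𝒩.ComputesBoundedError f →
      ∃ t : DecisionTree N, t.Computes f ∧ t.depth ≤ 4096 * T ^ 6 := by
  refine ⟨?_, fun T 𝒩 h => exists_decisionTree_of_computesBoundedError h⟩
  obtain ⟨𝒩, h𝒩⟩ : boundedErrorQuantumComplexity f ∈
      {T : ℕ | ∃ 𝒩 : QuantumNetwork N T, 𝒩.ComputesBoundedError f} :=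
    Nat.sInf_mem (exists_network_computesBoundedError f)
  obtain ⟨t, ht, hd⟩ := exists_decisionTree_of_computesBoundedError h𝒩
  have hle : decisionTreeComplexity f ≤ t.depth := Nat.sInf_le ⟨t, ht, rfl⟩
  exact hle.trans hd
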